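/- Let $\mathbb{F}$ be a field of characteristic different from $2$. A symplectic form $s$ on a finite-dimensional $\mathbb{F}$-vector space $V$ is a nondegenerate alternating bilinear form, and $\mathrm{Sp}(s)$ denotes the group of all linear automorphisms $u$ of $V$ with $s(u(x),u(y))=s(x,y)$ for all $x,y \in V$. In a group $G$, an involution is an element $g$ with $g^2=1$, and an element is called $k$-reflectional if it is the product of $k$ involutions of $G$. A polynomial $p \in \mathbb{F}[t]$ of degree $d>0$ is called a palindromial if $p(0) \neq 0$ and $p(t)=p(0)^{-1}t^d p(t^{-1})$. For $n \geq 1$, let $\ell_{2n}(\mathbb{F}) \in \mathbb{N} \cup \{+\infty\}$ be the least integer $k$ such that every element of $\mathrm{Sp}(s)$ is $k$-reflectional in $\mathrm{Sp}(s)$, where $s$ is a symplectic form on a $2n$-dimensional vector space over $\mathbb{F}$ (such a form is unique up to isometry), and $+\infty$ if no such integer exists. (i) Let $p \in \mathbb{F}[t]$ be a monic palindromial of degree $2$ with no root in $\{1,-1\}$. Let $s$ be a symplectic form on a finite-dimensional $\mathbb{F}$-vector space, and let $u \in \mathrm{Sp}(s)$ have minimal polynomial $(t-1)\,p(t)$ and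 be such that $\operatorname{Ker} p(u)$ has dimension $2$. Then $u$ is not $3$-reflectional in $\mathrm{Sp}(s)$. (ii) $\ell_{2n}(\mathbb{F}) \geq 4$ for every integer $n \geq 2$; that is, for every symplectic form $s$ on a $2n$-dimensional $\mathbb{F}$-vector space, if every element of $\mathrm{Sp}(s)$ is $k$-reflectional in $\mathrm{Sp}(s)$, then $k \geq 4$. -/

import Mathlib

open Polynomial

/-- A symplectic form on `V`: a nondegenerate alternating bilinear form. -/
structure IsSymplecticForm {F V : Type*} [Field F] [AddCommGroup V] [Module F V]
    (s : LinearMap.BilinForm F V) : Prop where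
  alt : s.IsAlt
  nondegenerate : s.Nondegenerate

/-- The group `Sp(s)` of all linear automorphisms of `V` that preserve `s`. -/
def Sp {F V : Type*} [Field F] [AddCommGroup V] [Module F V]
    (s : LinearMap.BilinForm F V) : Subgroup (V ≃ₗ[F] V) where
  carrier := {u | ∀ x y, s (u x) (u y) = s x y}
  mul_mem' := by
    intro u v hu hv x y
    simp only [LinearEquiv.mul_apply]
    rw [hu, hv]
  one_mem' := by
    intro x y
    rfl
  inv_mem' := by
    intro u hu x y
    have h := hu (u⁻¹ x) (u⁻¹ y)
    have e : ∀ z, u (u⁻¹ z) = z := fun z => u.apply_symm_apply z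
    rw [e, e] at h
    exact h.symm

/-- `g` is `k`-reflectional: it is a product of `k` involutions of `G`, an involution being
an element of order `1` or `2`. -/
def IsReflectional {G : Type*} [Group G] (k : ℕ) (g : G) : Prop :=
  ∃ l : List G, l.length = k ∧ (∀ i ∈ l, i ^ 2 = 1) ∧ l.prod = g

/-- The least `k` such that every element of `G` is `k`-reflectional, and `⊤` if there is none. -/
noncomputable def reflectionalLength (G : Type*) [Group G] : ℕ∞ :=
  ⨅ (k : ℕ) (_ : ∀ g : G, IsReflectional k g), (k : ℕ∞)

/-- The standard symplectic form on `F ^ (2 n)`. -/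
noncomputable def stdSymplecticForm (F : Type*) [Field F] (n : ℕ) :
    LinearMap.BilinForm F (Fin n ⊕ Fin n → F) :=
  Matrix.toBilin' (Matrix.J (Fin n) F)

theorem isSymplecticForm_stdSymplecticForm (F : Type*) [Field F] (n : ℕ) :
    IsSymplecticForm (stdSymplecticForm F n) where
  alt := by
    intro x
    simp [stdSymplecticForm, Matrix.toBilin'_apply', Matrix.J, Matrix.fromBlocks_mulVec,
      Matrix.neg_mulVec, dotProduct, Fintype.sum_sum_type, mul_comm]
  nondegenerate := by
    apply LinearMap.BilinForm.nondegenerate_toBilin'_of_det_ne_zero'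
    exact (Matrix.isUnit_det_J (Fin n) F).ne_zero

/-- The invariant `ℓ_{2n}(F)`: the least `k` such that every element of the symplectic group of
a symplectic form of dimension `2 n` over `F` is `k`-reflectional. Such forms being unique up to
isometry, the standard one is used. -/
noncomputable def ell2 (F : Type*) [Field F] (n : ℕ) : ℕ∞ :=
  reflectionalLength (Sp (stdSymplecticForm F n))

/-- The reciprocal polynomial `p(0)⁻¹ t ^ d p(t⁻¹)`, where `d = deg p`. -/
noncomputable def reciprocalPoly {F : Type*} [Field F] (p : F[X]) : F[X] :=
  C (p.eval 0)⁻¹ * p.reverse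

/-- A palindromial: a polynomial of positive degree equal to its reciprocal polynomial. -/
def IsPalindromial {F : Type*} [Field F] (p : F[X]) : Prop :=
  0 < p.natDegree ∧ p = reciprocalPoly p

/-! Suppose `u = abc` with symplectic involutions, so that `w = ab = uc` and `w⁻¹ = ba = cu⁻¹`.
Involutions in `Sp s` are self-adjoint, hence so is `h = w + w⁻¹`, which commutes with `a`. The
difference `k = w - w⁻¹` anticommutes with `a`, commutes with `h`, satisfies `k² = h² - 4`, and has
range in `P + cP` because `u - 1` and `u⁻¹ - 1` have range in `P`.

The lever is `exists_scalar_of_selfAdjoint`: on a regular space of dimension at most 2, self-adjoint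
means scalar. Applied to `c` compressed to `P`, it gives a scalar `α`. If `α² = 1`, an eigenspace of
`h` is an isometric copy of `P` on which `a` must be a scalar, while anticommuting there with the
invertible `k` (`false_of_sq_eq_one`). If `α² ≠ 1`, then `P ⊕ cP` is regular, and `h` is scalar
first on the fixed vectors of `a` in it, then on all of it, which forces `u = -1` somewhere on `P`
(`false_of_sq_ne_one`). For the lower bound, `P` is a hyperbolic plane carrying a quarter turn. -/

section Core

variable {F V : Type*} [Field F] [AddCommGroup V] [Module F V] {s : LinearMap.BilinForm F V}

/-- An endomorphism that is self-adjoint for an alternating form on a regular subspace of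
dimension at most `2` acts on it as a scalar. -/
theorem exists_scalar_of_selfAdjoint [FiniteDimensional F V] (h2 : (2 : F) ≠ 0) (hs : s.IsAlt)
    {E : Submodule F V} (hE : Module.finrank F E ≤ 2)
    (hreg : ∀ x ∈ E, (∀ y ∈ E, s x y = 0) → x = 0)
    {g : V →ₗ[F] V} (hgE : ∀ x ∈ E, g x ∈ E)
    (hg : ∀ x ∈ E, ∀ y ∈ E, s (g x) y = s x (g y)) :
    ∃ β : F, ∀ x ∈ E, g x = β • x := by
  by_cases hbot : ∀ x ∈ E, x = 0
  · exact ⟨0, fun x hx => by rw [hbot x hx]; simp⟩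
  push Not at hbot
  obtain ⟨e, he, he0⟩ := hbot
  obtain ⟨f, hf, hef⟩ : ∃ f ∈ E, s e f ≠ 0 := by
    by_contra! hcon
    exact he0 (hreg e he hcon)
  have hfe : s f e = -s e f := (LinearMap.IsAlt.neg hs e f).symm
  have hee : ∀ x, s x x = 0 := hs
  -- Self-adjointness makes `s x (g x)` equal to its own negative. In dimension 2, being orthogonal
  -- to `x` means being a multiple of `x`.
  have hself : ∀ x ∈ E, s x (g x) = 0 := by
    intro x hx
    have h1 := LinearMap.IsAlt.neg hs x (g x)
    rw [hg x hx x hx] at h1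
    have : (2 : F) * s x (g x) = 0 := by linear_combination -h1
    exact (mul_eq_zero.mp this).resolve_left h2
  have hli : LinearIndependent F ![e, f] := by
    rw [LinearIndependent.pair_iff]
    intro a b hab
    have h1 : s e (a • e + b • f) = 0 := by rw [hab]; simp
    have h3 : s f (a • e + b • f) = 0 := by rw [hab]; simp
    simp only [map_add, map_smul, smul_eq_mul, hee, hfe] at h1 h3
    constructor
    · have : a * s e f = 0 := by linear_combination -h3
      exact (mul_eq_zero.mp this).resolve_right hef
    · have : b * s e f = 0 := by linear_combination h1
      exact (mul_eq_zero.mp this).resolve_right hef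
  have hspan : Submodule.span F {e, f} = E := by
    apply Submodule.eq_of_le_of_finrank_le
    · rw [Submodule.span_le]
      rintro x (rfl | rfl) <;> assumption
    · have := finrank_span_eq_card hli
      rw [Matrix.range_cons_cons_empty] at this
      rw [this]
      simpa using hE
  have hcomb : ∀ x ∈ E, ∃ a b : F, a • e + b • f = x := by
    intro x hx
    rw [← hspan] at hx
    exact Submodule.mem_span_pair.mp hx
  obtain ⟨a, b, hab⟩ := hcomb _ (hgE e he)
  obtain ⟨a', b', hab'⟩ := hcomb _ (hgE f hf)
  have h1 := hself e he
  have h3 := hself f hf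
  have h4 := hg e he f hf
  rw [← hab] at h1 h4
  rw [← hab'] at h3 h4
  simp only [map_add, map_smul, smul_eq_mul, hee, hfe, LinearMap.add_apply, LinearMap.smul_apply]
    at h1 h3 h4
  have hb : b = 0 := by
    have : b * s e f = 0 := by linear_combination h1
    exact (mul_eq_zero.mp this).resolve_right hef
  have ha' : a' = 0 := by
    have : a' * s e f = 0 := by linear_combination -h3
    exact (mul_eq_zero.mp this).resolve_right hef
  have hb' : a = b' := by
    have : (a - b') * s e f = 0 := by linear_combination h4
    exact sub_eq_zero.mp ((mul_eq_zero.mp this).resolve_right hef)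
  subst hb ha' hb'
  refine ⟨a, fun x hx => ?_⟩
  obtain ⟨p, q, rfl⟩ := hcomb x hx
  rw [map_add, map_smul, map_smul, ← hab, ← hab']
  module

/-- The situation of a symplectic transformation `u` with inverse `u'` that is the product of
three symplectic involutions `a`, `b`, `c` and satisfies `u + u⁻¹ = lam` on a subspace `P` of
dimension at most `2` that contains the range of `u - 1`. -/
structure ThreeInvolutions (s : LinearMap.BilinForm F V) (P : Submodule F V) (lam : F)
    (u u' a b c : V →ₗ[F] V) : Prop where
  two_ne : (2 : F) ≠ 0
  lam_ne : lam ≠ 2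
  lam_ne' : lam ≠ -2
  alt : s.IsAlt
  sep : ∀ x, (∀ y, s x y = 0) → x = 0
  finrank_le : Module.finrank F P ≤ 2
  ne_bot : P ≠ ⊥
  sub_mem : ∀ x, u x - x ∈ P
  add_eq : ∀ x ∈ P, u x + u' x = lam • x
  u_u' : ∀ x, u (u' x) = x
  u'_u : ∀ x, u' (u x) = x
  adj_u : ∀ x y, s (u x) y = s x (u' y)
  adj_a : ∀ x y, s (a x) y = s x (a y)
  adj_b : ∀ x y, s (b x) y = s x (b y)
  adj_c : ∀ x y, s (c x) y = s x (c y)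
  aa : ∀ x, a (a x) = x
  bb : ∀ x, b (b x) = x
  cc : ∀ x, c (c x) = x
  eq : ∀ x, a (b x) = u (c x)

/-! ### Projection onto `P`, the scalar `α`, and the identities for `w ± w⁻¹` -/

namespace ThreeInvolutions

variable {P : Submodule F V} {lam : F} {u u' a b c : V →ₗ[F] V}

theorem adj_u' (H : ThreeInvolutions s P lam u u' a b c) (x y : V) : s (u' x) y = s x (u y) := by
  have h1 := H.adj_u (u' x) (u y)
  rw [H.u_u', H.u'_u] at h1
  exact h1.symm

theorem eq' (H : ThreeInvolutions s P lam u u' a b c) (x : V) : b (a x) = c (u' x) := by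
  have h1 := H.eq (b (a x))
  rw [H.bb, H.aa] at h1
  conv_rhs => rw [h1, H.u'_u, H.cc]

theorem u_mem (H : ThreeInvolutions s P lam u u' a b c) {x : V} (hx : x ∈ P) : u x ∈ P := by
  simpa using P.add_mem (H.sub_mem x) hx

theorem u'_mem (H : ThreeInvolutions s P lam u u' a b c) {x : V} (hx : x ∈ P) : u' x ∈ P := by
  have h1 : u' x = lam • x - u x := by rw [← H.add_eq x hx]; abel
  rw [h1]
  exact P.sub_mem (P.smul_mem _ hx) (H.u_mem hx)

theorem u'_sub_mem (H : ThreeInvolutions s P lam u u' a b c) (x : V) : u' x - x ∈ P := by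
  have h1 := H.u'_mem (H.sub_mem x)
  rw [map_sub, H.u'_u] at h1
  simpa using P.neg_mem h1

/-- The orthogonal projection onto `P` along the fixed space of `u`. -/
theorem exists_projection (H : ThreeInvolutions s P lam u u' a b c) :
    ∃ π : V →ₗ[F] V, (∀ x, π x ∈ P) ∧ (∀ x ∈ P, π x = x) ∧
    (∀ x y, s (π x) y = s x (π y)) ∧ (∀ x, u x = x + (u (π x) - π x)) ∧
    (∀ x, u' x = x + (u' (π x) - π x)) := by
  have hl : lam - 2 ≠ 0 := sub_ne_zero.mpr H.lam_ne
  -- `u + u⁻¹ - 2` vanishes on the fixed space of `u` and is the nonzero scalar `lam - 2` on `P`, so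
  -- rescaling it gives the projection.
  have hid : ∀ x ∈ P, (lam - 2)⁻¹ • (u x + u' x - (2 : F) • x) = x := by
    intro x hx
    rw [H.add_eq x hx, ← sub_smul, smul_smul, inv_mul_cancel₀ hl, one_smul]
  refine ⟨(lam - 2)⁻¹ • (u + u' - (2 : F) • LinearMap.id), fun x => ?_, fun x hx => ?_,
    fun x y => ?_, fun x => ?_, fun x => ?_⟩
  · have h1 := P.add_mem (H.sub_mem x) (H.u'_sub_mem x)
    have h3 : u x + u' x - (2 : F) • x = u x - x + (u' x - x) := by module
    simp only [LinearMap.smul_apply, LinearMap.sub_apply, LinearMap.add_apply, LinearMap.id_apply]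
    rw [h3]
    exact P.smul_mem _ h1
  · simpa using hid x hx
  · simp only [LinearMap.smul_apply, LinearMap.sub_apply, LinearMap.add_apply, LinearMap.id_apply,
      map_sub, map_add, map_smul, smul_eq_mul, H.adj_u, H.adj_u']
    ring
  · have h1 := hid _ (H.sub_mem x)
    simp only [LinearMap.smul_apply, LinearMap.sub_apply, LinearMap.add_apply, LinearMap.id_apply,
      map_sub, map_add, map_smul, H.u_u', H.u'_u] at h1 ⊢
    linear_combination (norm := module) -h1
  · have h1 := hid _ (H.u'_sub_mem x)
    simp only [LinearMap.smul_apply, LinearMap.sub_apply, LinearMap.add_apply, LinearMap.id_apply,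
      map_sub, map_add, map_smul, H.u_u', H.u'_u] at h1 ⊢
    linear_combination (norm := module) -h1

theorem regular (H : ThreeInvolutions s P lam u u' a b c) :
    ∀ x ∈ P, (∀ y ∈ P, s x y = 0) → x = 0 := by
  obtain ⟨π, hπP, hπ, hadj, -, -⟩ := H.exists_projection
  intro x hx hxy
  refine H.sep x fun y => ?_
  rw [← hπ x hx, hadj]
  exact hxy _ (hπP y)

/-- The compression `π ∘ c` is self-adjoint on the regular space `P`, hence a scalar `α`. Since `u -
1` factors through `π`, the scalar determines how `u` and `u⁻¹` act on `cP`. -/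
theorem exists_alpha [FiniteDimensional F V] (H : ThreeInvolutions s P lam u u' a b c) :
    ∃ α : F, (∀ x ∈ P, ∀ y ∈ P, s x (c y) = α * s x y) ∧
    (∀ x ∈ P, u (c x) = c x + α • (u x - x)) ∧ (∀ x ∈ P, u' (c x) = c x + α • (u' x - x)) ∧
    (∀ x ∈ P, c x ∈ P → c x = α • x) := by
  obtain ⟨π, hπP, hπ, hadj, hu, hu'⟩ := H.exists_projection
  obtain ⟨α, hα⟩ := exists_scalar_of_selfAdjoint (g := π ∘ₗ c) H.two_ne H.alt H.finrank_le
    H.regular (fun x _ => hπP _) (fun x hx y hy => by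
      simp only [LinearMap.comp_apply]
      rw [hadj, hπ y hy, H.adj_c, ← hadj, hπ x hx])
  simp only [LinearMap.comp_apply] at hα
  refine ⟨α, fun x hx y hy => ?_, fun x hx => ?_, fun x hx => ?_, fun x hx hcx => ?_⟩
  · rw [← hπ x hx, hadj, hα y hy]
    simp [hπ x hx]
  · rw [hu, hα x hx, map_smul, smul_sub]
  · rw [hu', hα x hx, map_smul, smul_sub]
  · rw [← hα x hx, hπ _ hcx]

/-- `w + w⁻¹`, where `w = ab = uc`, is `s`-self-adjoint. -/
theorem adj_sum (H : ThreeInvolutions s P lam u u' a b c) (x y : V) :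
    s ((a ∘ₗ b + b ∘ₗ a) x) y = s x ((a ∘ₗ b + b ∘ₗ a) y) := by
  simp [H.adj_a, H.adj_b, add_comm]

theorem sum_comm_a (H : ThreeInvolutions s P lam u u' a b c) (x : V) :
    (a ∘ₗ b + b ∘ₗ a) (a x) = a ((a ∘ₗ b + b ∘ₗ a) x) := by
  simp [H.aa, add_comm]

theorem diff_anticomm_a (H : ThreeInvolutions s P lam u u' a b c) (x : V) :
    (a ∘ₗ b - b ∘ₗ a) (a x) = -a ((a ∘ₗ b - b ∘ₗ a) x) := by
  simp [H.aa]

theorem sum_comm_diff (H : ThreeInvolutions s P lam u u' a b c) (x : V) :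
    (a ∘ₗ b + b ∘ₗ a) ((a ∘ₗ b - b ∘ₗ a) x) = (a ∘ₗ b - b ∘ₗ a) ((a ∘ₗ b + b ∘ₗ a) x) := by
  simp only [LinearMap.add_apply, LinearMap.sub_apply, LinearMap.comp_apply, map_add, map_sub,
    H.aa, H.bb]
  abel

theorem diff_diff (H : ThreeInvolutions s P lam u u' a b c) (x : V) :
    (a ∘ₗ b - b ∘ₗ a) ((a ∘ₗ b - b ∘ₗ a) x) =
    (a ∘ₗ b + b ∘ₗ a) ((a ∘ₗ b + b ∘ₗ a) x) - (4 : F) • x := by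
  simp only [LinearMap.add_apply, LinearMap.sub_apply, LinearMap.comp_apply, map_add, map_sub,
    H.aa, H.bb]
  module

theorem diff_range (H : ThreeInvolutions s P lam u u' a b c) (x : V) :
    ∃ y ∈ P, ∃ z ∈ P, (a ∘ₗ b - b ∘ₗ a) x = y + c z := by
  refine ⟨u (c x) - c x, H.sub_mem _, -(u' x - x), P.neg_mem (H.u'_sub_mem x), ?_⟩
  simp [H.eq, H.eq']

/-- Here `r = α - c` maps `P` to a totally isotropic space orthogonal to `P`, on which `h = -2α`.
Modulo `r(P)`, `h` acts on `P` as `α * lam`. As the two values differ, `P` can be tilted along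
`r(P)` into a genuine eigenspace without changing the form. -/
theorem false_of_sq_eq_one [FiniteDimensional F V] (H : ThreeInvolutions s P lam u u' a b c)
    {α : F} (hα : α ^ 2 = 1)
    (hsc : ∀ x ∈ P, ∀ y ∈ P, s x (c y) = α * s x y)
    (hu : ∀ x ∈ P, u (c x) = c x + α • (u x - x))
    (hu' : ∀ x ∈ P, u' (c x) = c x + α • (u' x - x)) : False := by
  have h2 := H.two_ne
  have hl : lam + 2 ≠ 0 := fun h => H.lam_ne' (eq_neg_of_add_eq_zero_left h)
  have hl' : lam - 2 ≠ 0 := sub_ne_zero.mpr H.lam_ne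
  have hα0 : α ≠ 0 := by rintro rfl; simp at hα
  have hm : α * (lam + 2) ≠ 0 := mul_ne_zero hα0 hl
  obtain ⟨h, hh⟩ : ∃ h, h = a ∘ₗ b + b ∘ₗ a := ⟨_, rfl⟩
  obtain ⟨k, hk⟩ : ∃ k, k = a ∘ₗ b - b ∘ₗ a := ⟨_, rfl⟩
  have hha := H.sum_comm_a
  have hka := H.diff_anticomm_a
  have hhk := H.sum_comm_diff
  have hkk := H.diff_diff
  have hkr := H.diff_range
  rw [← hk] at hka hhk hkk hkr
  rw [← hh] at hha hhk hkk
  have hhx : ∀ x, h x = u (c x) + c (u' x) := by simp [hh, H.eq, H.eq']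
  obtain ⟨r, hr⟩ : ∃ r : V →ₗ[F] V, ∀ x, r x = α • x - c x := ⟨α • LinearMap.id - c, by simp⟩
  have hα2 : α * α = 1 := by rw [← sq, hα]
  have hP : ∀ x ∈ P, h x = (α * lam) • x - r (x + u' x) := by
    intro x hx
    have h1 := congrArg (fun z => α • z) (H.add_eq x hx)
    simp only [smul_add] at h1
    rw [hhx, hu x hx, hr, map_add]
    linear_combination (norm := module) h1
  have hR : ∀ x ∈ P, h (r x) = (-2 * α) • r x := by
    intro x hx
    have e1 : u (r x) = r x := by
      rw [hr, map_sub, map_smul, hu x hx]; module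
    have e2 : u' (r x) = r x := by
      rw [hr, map_sub, map_smul, hu' x hx]; module
    have e3 : c (r x) = -α • r x := by
      rw [hr, map_sub, map_smul, H.cc]
      linear_combination (norm := module) hα2 • x
    rw [hhx, e3, e2, map_smul, e1, e3]
    module
  -- The denominator is the eigenvalue gap `α * lam - (-2 * α)`.
  obtain ⟨φ, hφ⟩ : ∃ φ : V →ₗ[F] V, ∀ x, φ x = x - (α * (lam + 2))⁻¹ • r (x + u' x) :=
    ⟨LinearMap.id - (α * (lam + 2))⁻¹ • (r ∘ₗ (LinearMap.id + u')), by simp⟩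
  have hφh : ∀ x ∈ P, h (φ x) = (α * lam) • φ x := by
    intro x hx
    rw [hφ, map_sub, map_smul, hP x hx, hR _ (P.add_mem hx (H.u'_mem hx))]
    have : (α * (lam + 2)) * (α * (lam + 2))⁻¹ = 1 := mul_inv_cancel₀ hm
    linear_combination (norm := module) this • r (x + u' x)
  have hsr : ∀ x ∈ P, ∀ y ∈ P, s x (r y) = 0 := by
    intro x hx y hy
    rw [hr, map_sub, map_smul, hsc x hx y hy]
    simp
  have hrs : ∀ x ∈ P, ∀ y ∈ P, s (r y) x = 0 := by
    intro x hx y hy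
    rw [← LinearMap.IsAlt.neg H.alt, hsr x hx y hy, neg_zero]
  have hrr : ∀ x ∈ P, ∀ y ∈ P, s (r x) (r y) = 0 := by
    intro x hx y hy
    have e3 : c (r y) = -α • r y := by
      rw [hr, map_sub, map_smul, H.cc]
      linear_combination (norm := module) hα2 • y
    rw [hr x, map_sub, map_smul, LinearMap.sub_apply, LinearMap.smul_apply, hsr x hx y hy,
      H.adj_c, e3, map_smul, hsr x hx y hy]
    simp
  have hφs : ∀ x ∈ P, ∀ y ∈ P, s (φ x) (φ y) = s x y := by
    intro x hx y hy
    have hx' := P.add_mem hx (H.u'_mem hx)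
    have hy' := P.add_mem hy (H.u'_mem hy)
    rw [hφ, hφ]
    simp only [map_sub, map_smul, LinearMap.sub_apply, LinearMap.smul_apply]
    rw [hsr x hx _ hy', hrs y hy _ hx', hrr _ hx' _ hy']
    simp
  -- On such `v`, `k² = h² - 4` is the nonzero scalar `lam² - 4`, so `v` lies in the range of `k`,
  -- hence in `P + cP = P + r(P)`.
  have hEφ : ∀ v, h v = (α * lam) • v → ∃ x ∈ P, v = φ x := by
    intro v hv
    obtain ⟨y, hy, z, hz, hyz⟩ := hkr (k v)
    rw [hkk, hv, map_smul, hv] at hyz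
    have hyz' : ((lam + 2) * (lam - 2)) • v = y + c z := by
      linear_combination (norm := module) hyz - (lam * lam) • hα2 • v
    have hne : (lam + 2) * (lam - 2) ≠ 0 := mul_ne_zero hl hl'
    obtain ⟨x, hx, t, ht, hv'⟩ : ∃ x ∈ P, ∃ t ∈ P, v = x + r t := by
      refine ⟨((lam + 2) * (lam - 2))⁻¹ • (y + α • z), P.smul_mem _ (P.add_mem hy (P.smul_mem _ hz)),
        -((lam + 2) * (lam - 2))⁻¹ • z, P.smul_mem _ hz, ?_⟩
      have e1 := congrArg (fun q => ((lam + 2) * (lam - 2))⁻¹ • q) hyz'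
      simp only [smul_smul, inv_mul_cancel₀ hne, one_smul] at e1
      rw [e1, hr, map_smul]
      module
    refine ⟨x, hx, ?_⟩
    have e1 := hv
    rw [hv', map_add, hP x hx, hR t ht] at e1
    have e2 : (α * (lam + 2)) • r t = -r (x + u' x) := by
      linear_combination (norm := module) -e1
    have e3 := congrArg (fun q => (α * (lam + 2))⁻¹ • q) e2
    simp only [smul_smul, inv_mul_cancel₀ hm, one_smul] at e3
    rw [hv', hφ, e3]
    module
  let E : Submodule F V := LinearMap.ker (h - (α * lam) • LinearMap.id)
  have hE : ∀ v, v ∈ E ↔ h v = (α * lam) • v := by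
    intro v
    simp [E, sub_eq_zero]
  have hEle : E ≤ P.map φ := by
    intro v hv
    obtain ⟨x, hx, rfl⟩ := hEφ v ((hE v).mp hv)
    exact Submodule.mem_map_of_mem hx
  obtain ⟨β, hβ⟩ := exists_scalar_of_selfAdjoint (g := a) (E := E) h2 H.alt
    (((Submodule.finrank_mono hEle).trans (Submodule.finrank_map_le φ P)).trans H.finrank_le)
    (fun v hv hvy => by
      obtain ⟨x, hx, rfl⟩ := hEφ v ((hE v).mp hv)
      have : x = 0 := H.regular x hx fun y hy => by
        rw [← hφs x hx y hy]
        exact hvy _ ((hE _).mpr (hφh y hy))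
      simp [this])
    (fun v hv => by
      rw [hE] at hv ⊢
      rw [hha, hv, map_smul])
    (fun x _ y _ => H.adj_a x y)
  obtain ⟨x, hx, hx0⟩ := Submodule.exists_mem_ne_zero_of_ne_bot H.ne_bot
  have hv := (hE _).mpr (hφh x hx)
  -- `k` preserves the eigenspace and anticommutes with the nonzero scalar `a` there, so it
  -- vanishes, against `k² = lam² - 4 ≠ 0`.
  have hkv : k (φ x) ∈ E := by
    rw [hE] at hv ⊢
    rw [hhk, hv, map_smul]
  have h3 := hβ _ hkv
  have h4 := hka (φ x)
  have h5 := hβ _ hv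
  rw [h5, map_smul, h3] at h4
  have h6 : (2 * β) • k (φ x) = 0 := by linear_combination (norm := module) h4
  have hφ0 : φ x ≠ 0 := by
    intro h0
    apply hx0
    refine H.regular x hx fun y hy => ?_
    rw [← hφs x hx y hy, h0]
    simp
  have hβ0 : β ≠ 0 := by
    rintro rfl
    apply hφ0
    rw [← H.aa (φ x), h5]
    simp
  have h7 : k (φ x) = 0 := (smul_eq_zero.mp h6).resolve_left (mul_ne_zero h2 hβ0)
  have h8 := hkk (φ x)
  rw [h7, map_zero, hφh x hx, map_smul, hφh x hx] at h8
  have h9 : ((lam + 2) * (lam - 2)) • φ x = 0 := by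
    linear_combination (norm := module) -h8 - (lam * lam) • hα2 • φ x
  exact hφ0 ((smul_eq_zero.mp h9).resolve_left (mul_ne_zero hl hl'))

end ThreeInvolutions

end Core

/-! ### The nondegenerate case `α² ≠ 1` -/

namespace ThreeInvolutions

variable {F V : Type*} [Field F] [AddCommGroup V] [Module F V] {s : LinearMap.BilinForm F V}
  {P : Submodule F V} {lam : F} {u u' a b c : V →ₗ[F] V}

/-- The matrix with rows `(1, α)` and `(α, 1)` is invertible. This makes `U = P ⊕ cP` both regular
and a space on which `k` is bijective. -/
theorem false_of_sq_ne_one [FiniteDimensional F V] (H : ThreeInvolutions s P lam u u' a b c)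
    {α : F} (hα : α ^ 2 ≠ 1)
    (hsc : ∀ x ∈ P, ∀ y ∈ P, s x (c y) = α * s x y)
    (hu : ∀ x ∈ P, u (c x) = c x + α • (u x - x))
    (hu' : ∀ x ∈ P, u' (c x) = c x + α • (u' x - x))
    (hcP : ∀ x ∈ P, c x ∈ P → c x = α • x) : False := by
  have h2 := H.two_ne
  have hα1 : 1 - α * α ≠ 0 := fun h => hα (by linear_combination -h)
  have hl' : lam - 2 ≠ 0 := sub_ne_zero.mpr H.lam_ne
  obtain ⟨h, hh⟩ : ∃ h, h = a ∘ₗ b + b ∘ₗ a := ⟨_, rfl⟩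
  obtain ⟨k, hk⟩ : ∃ k, k = a ∘ₗ b - b ∘ₗ a := ⟨_, rfl⟩
  have hha := H.sum_comm_a
  have hka := H.diff_anticomm_a
  have hhk := H.sum_comm_diff
  have hkr := H.diff_range
  have hadj := H.adj_sum
  rw [← hk] at hka hhk hkr
  rw [← hh] at hha hhk hadj
  have hhx : ∀ x, h x = u (c x) + c (u' x) := by simp [hh, H.eq, H.eq']
  have hkx : ∀ x, k x = u (c x) - c (u' x) := by simp [hk, H.eq, H.eq']
  have hdisj : ∀ x ∈ P, c x ∈ P → x = 0 := by
    intro x hx hcx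
    have h1 := hcP x hx hcx
    have h3 : c (c x) = (α * α) • x := by rw [h1, map_smul, h1, smul_smul]
    rw [H.cc] at h3
    have h4 : (1 - α * α) • x = 0 := by linear_combination (norm := module) h3
    exact (smul_eq_zero.mp h4).resolve_left hα1
  have hind : ∀ x ∈ P, ∀ y ∈ P, x + c y = 0 → x = 0 ∧ y = 0 := by
    intro x hx y hy hxy
    have hy0 : y = 0 := by
      apply hdisj y hy
      rw [eq_neg_of_add_eq_zero_right hxy]
      exact P.neg_mem hx
    subst hy0
    simpa using hxy
  have hsolve : ∀ x y : V, x + α • y = 0 → α • x + y = 0 → x = 0 ∧ y = 0 := by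
    intro x y h1 h3
    constructor
    · have : (1 - α * α) • x = 0 := by linear_combination (norm := module) h1 - α • h3
      exact (smul_eq_zero.mp this).resolve_left hα1
    · have : (1 - α * α) • y = 0 := by linear_combination (norm := module) h3 - α • h1
      exact (smul_eq_zero.mp this).resolve_left hα1
  have hu1 : ∀ x ∈ P, u x - x = 0 → x = 0 := by
    intro x hx hx1
    have h1 := H.add_eq x hx
    have h3 : u x = x := sub_eq_zero.mp hx1
    have h4 : u' x = x := by conv_lhs => rw [← h3, H.u'_u]
    rw [h3, h4] at h1
    have h5 : (lam - 2) • x = 0 := by linear_combination (norm := module) -h1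
    exact (smul_eq_zero.mp h5).resolve_left hl'
  have hu_inv_one : ∀ x ∈ P, u' x - x = 0 → x = 0 := by
    intro x hx hx1
    apply hu1 x hx
    have h4 : u' x = x := sub_eq_zero.mp hx1
    have : u x = x := by conv_lhs => rw [← h4, H.u_u']
    rw [this, sub_self]
  let U : Submodule F V := P ⊔ P.map c
  have hU : ∀ v, v ∈ U ↔ ∃ x ∈ P, ∃ y ∈ P, v = x + c y := by
    intro v
    simp [U, Submodule.mem_sup, eq_comm]
  have hkU : ∀ v, k v ∈ U := fun v => (hU _).mpr (hkr v)
  have hkinj : ∀ v ∈ U, k v = 0 → v = 0 := by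
    intro v hv hkv
    obtain ⟨x, hx, y, hy, rfl⟩ := (hU v).mp hv
    -- The left side is `k (x + c y)`, split along `P ⊕ cP`; neither `u - 1` nor `u⁻¹ - 1` kills a
    -- nonzero vector of `P`.
    have h1 : (u (α • x + y) - (α • x + y)) + c (-(u' (x + α • y) - (x + α • y))) = 0 := by
      rw [← hkv, map_add k, hkx, hkx, hu x hx, H.cc, hu' y hy]
      simp only [map_add, map_smul, map_sub, map_neg, H.cc]
      module
    have hm1 : α • x + y ∈ P := P.add_mem (P.smul_mem _ hx) hy
    have hm2 : x + α • y ∈ P := P.add_mem hx (P.smul_mem _ hy)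
    obtain ⟨h3, h4⟩ := hind _ (H.sub_mem _) _ (P.neg_mem (H.u'_sub_mem _)) h1
    obtain ⟨rfl, rfl⟩ := hsolve x y (hu_inv_one _ hm2 (neg_eq_zero.mp h4)) (hu1 _ hm1 h3)
    simp
  have hkUU : ∀ v ∈ U, ∃ t ∈ U, k t = v := by
    let kU : U →ₗ[F] U := k.restrict (fun v _ => hkU v)
    have hinj : Function.Injective kU := by
      rw [injective_iff_map_eq_zero]
      intro v hv
      exact Subtype.ext (hkinj v v.2 (congrArg Subtype.val hv))
    intro v hv
    obtain ⟨t, ht⟩ := LinearMap.surjective_of_injective hinj ⟨v, hv⟩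
    exact ⟨t, t.2, congrArg Subtype.val ht⟩
  -- Stability comes from `U = k(U)`: `a` carries values of `k` to values of `k`, and these all lie
  -- in `U`.
  have haU : ∀ v ∈ U, a v ∈ U := by
    intro v hv
    obtain ⟨t, -, rfl⟩ := hkUU v hv
    have h1 := hka t
    rw [← neg_eq_iff_eq_neg] at h1
    rw [← h1]
    exact U.neg_mem (hkU _)
  have hhU : ∀ v ∈ U, h v ∈ U := by
    intro v hv
    obtain ⟨t, -, rfl⟩ := hkUU v hv
    rw [hhk]
    exact hkU _
  have hUreg : ∀ v ∈ U, (∀ t ∈ U, s v t = 0) → v = 0 := by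
    intro v hv hvt
    obtain ⟨x, hx, y, hy, rfl⟩ := (hU v).mp hv
    have h1 : x + α • y = 0 := by
      refine H.regular _ (P.add_mem hx (P.smul_mem _ hy)) fun z hz => ?_
      have := hvt z ((hU _).mpr ⟨z, hz, 0, P.zero_mem, by simp⟩)
      rw [map_add, LinearMap.add_apply, H.adj_c, hsc y hy z hz] at this
      simpa using this
    have h3 : α • x + y = 0 := by
      refine H.regular _ (P.add_mem (P.smul_mem _ hx) hy) fun z hz => ?_
      have := hvt (c z) ((hU _).mpr ⟨0, P.zero_mem, z, hz, by simp⟩)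
      rw [map_add, LinearMap.add_apply, H.adj_c, H.cc, hsc x hx z hz] at this
      simpa using this
    obtain ⟨rfl, rfl⟩ := hsolve x y h1 h3
    simp
  let Ep : Submodule F V := U ⊓ LinearMap.ker (a - LinearMap.id)
  let Em : Submodule F V := U ⊓ LinearMap.ker (a + LinearMap.id)
  have hEp : ∀ v, v ∈ Ep ↔ v ∈ U ∧ a v = v := by
    intro v
    simp [Ep, sub_eq_zero]
  have hEm : ∀ v, v ∈ Em ↔ v ∈ U ∧ a v = -v := by
    intro v
    simp [Em, add_eq_zero_iff_eq_neg]
  have hinf : Ep ⊓ Em = ⊥ := by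
    rw [eq_bot_iff]
    rintro v ⟨hp, hm⟩
    have h1 := ((hEp v).mp hp).2
    have h3 := ((hEm v).mp hm).2
    have h4 : (2 : F) • v = 0 := by linear_combination (norm := module) h3 - h1
    exact (smul_eq_zero.mp h4).resolve_left h2
  have hsup : Ep ⊔ Em ≤ U := sup_le inf_le_left inf_le_left
  have hrU : Module.finrank F U ≤ 4 := by
    have h1 := Submodule.finrank_add_le_finrank_add_finrank P (P.map c)
    have h3 := Submodule.finrank_map_le c P
    have h4 := H.finrank_le
    change Module.finrank F (P ⊔ P.map c : Submodule F V) ≤ 4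
    omega
  -- Anticommutation makes `k` send `Ep` injectively into `Em`; since `dim U ≤ 4`, this bounds `dim
  -- Ep` by 2.
  have hle : Module.finrank F Ep ≤ Module.finrank F Em := by
    let f : Ep →ₗ[F] Em := k.restrict (fun v hv => by
      rw [hEm]
      refine ⟨hkU v, ?_⟩
      have h1 := hka v
      rw [((hEp v).mp hv).2] at h1
      exact (neg_eq_iff_eq_neg.mpr h1).symm)
    apply LinearMap.finrank_le_finrank_of_injective (f := f)
    rw [injective_iff_map_eq_zero]
    intro v hv
    exact Subtype.ext (hkinj v ((hEp v).mp v.2).1 (congrArg Subtype.val hv))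
  have hrEp : Module.finrank F Ep ≤ 2 := by
    have h1 := Submodule.finrank_sup_add_finrank_inf_eq Ep Em
    have h3 := Submodule.finrank_mono hsup
    rw [hinf, finrank_bot] at h1
    omega
  obtain ⟨e, he⟩ := exists_scalar_of_selfAdjoint (g := h) (E := Ep) h2 H.alt hrEp
    (fun v hv hvy => by
      obtain ⟨hvU, hav⟩ := (hEp v).mp hv
      refine hUreg v hvU fun t ht => ?_
      -- Symmetrizing `t` under `a` lands in `Ep` and doubles its pairing with `v`, so regularity
      -- descends from `U`.
      have h1 := hvy (t + a t) ((hEp _).mpr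
        ⟨U.add_mem ht (haU t ht), by rw [map_add, H.aa, add_comm]⟩)
      rw [map_add, ← H.adj_a, hav] at h1
      have h3 : (2 : F) * s v t = 0 := by linear_combination h1
      exact (mul_eq_zero.mp h3).resolve_left h2)
    (fun v hv => by
      rw [hEp] at hv ⊢
      exact ⟨hhU v hv.1, by rw [← hha, hv.2]⟩)
    (fun x _ y _ => hadj x y)
  have heU : ∀ v ∈ U, h v = e • v := by
    have hm : ∀ v ∈ Em, h v = e • v := by
      intro v hv
      obtain ⟨hvU, hav⟩ := (hEm v).mp hv
      have h1 : k v ∈ Ep := by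
        rw [hEp]
        refine ⟨hkU v, ?_⟩
        have h1 := hka v
        rw [hav, map_neg] at h1
        exact (neg_injective h1).symm
      have h3 := he _ h1
      rw [hhk] at h3
      rw [← sub_eq_zero]
      apply hkinj _ (U.sub_mem (hhU v hvU) (U.smul_mem _ hvU))
      rw [map_sub, map_smul, h3, sub_self]
    intro v hv
    have h1 := he (v + a v) ((hEp _).mpr
        ⟨U.add_mem hv (haU v hv), by rw [map_add, H.aa, add_comm]⟩)
    have h3 := hm (v - a v) ((hEm _).mpr
        ⟨U.sub_mem hv (haU v hv), by rw [map_sub, H.aa, neg_sub]⟩)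
    rw [map_add] at h1
    rw [map_sub] at h3
    have h4 : (2 : F) • (h v - e • v) = 0 := by linear_combination (norm := module) h1 + h3
    exact sub_eq_zero.mp ((smul_eq_zero.mp h4).resolve_left h2)
  obtain ⟨x, hx, hx0⟩ := Submodule.exists_mem_ne_zero_of_ne_bot H.ne_bot
  have h1 := heU x ((hU _).mpr ⟨x, hx, 0, P.zero_mem, by simp⟩)
  rw [hhx, hu x hx] at h1
  -- The scalar action of `h` puts `c (x + u' x)` in `P`, and `P` meets `cP` trivially.
  have h3 : x + u' x = 0 := by
    apply hdisj _ (P.add_mem hx (H.u'_mem hx))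
    have : c (x + u' x) = e • x - α • (u x - x) := by
      rw [map_add]
      linear_combination (norm := module) h1
    rw [this]
    exact P.sub_mem (P.smul_mem _ hx) (P.smul_mem _ (H.sub_mem x))
  have h4 : u' x = -x := (neg_eq_of_add_eq_zero_right h3).symm
  have h5 : u x = -x := by
    have := H.u_u' x
    rw [h4, map_neg] at this
    rw [← this, neg_neg, this]
  have h6 := H.add_eq x hx
  rw [h4, h5] at h6
  have h7 : (lam + 2) • x = 0 := by linear_combination (norm := module) -h6
  exact H.lam_ne' (eq_neg_of_add_eq_zero_left ((smul_eq_zero.mp h7).resolve_right hx0))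

theorem elim [FiniteDimensional F V] (H : ThreeInvolutions s P lam u u' a b c) : False := by
  obtain ⟨α, hsc, hu, hu', hcP⟩ := H.exists_alpha
  by_cases hα : α ^ 2 = 1
  · exact H.false_of_sq_eq_one hα hsc hu hu'
  · exact H.false_of_sq_ne_one hα hsc hu hu' hcP

end ThreeInvolutions

/-! ### Translation to `Sp s` and to reflectional lengths -/

section Main

variable {F V : Type*} [Field F] [AddCommGroup V] [Module F V]
  {s : LinearMap.BilinForm F V}

theorem Sp.apply_adjoint (u : Sp s) (x y : V) :
    s ((u : V ≃ₗ[F] V) x) y = s x ((u : V ≃ₗ[F] V).symm y) := by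
  have h := u.2 x ((u : V ≃ₗ[F] V).symm y)
  rwa [LinearEquiv.apply_symm_apply] at h

theorem Sp.involution_apply {a : Sp s} (ha : a ^ 2 = 1) (x : V) :
    (a : V ≃ₗ[F] V) ((a : V ≃ₗ[F] V) x) = x := by
  rw [sq] at ha
  exact LinearEquiv.congr_fun (congrArg Subtype.val ha) x

theorem Sp.involution_adjoint {a : Sp s} (ha : a ^ 2 = 1) (x y : V) :
    s ((a : V ≃ₗ[F] V) x) y = s x ((a : V ≃ₗ[F] V) y) := by
  have h := a.2 x ((a : V ≃ₗ[F] V) y)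
  rwa [Sp.involution_apply ha] at h

/-- A symplectic transformation that satisfies `u + u⁻¹ = lam` with `lam ≠ ±2` on a subspace of
dimension `1` or `2` containing the range of `u - 1` is not `3`-reflectional. -/
theorem Sp.not_isReflectional_three [FiniteDimensional F V] (h2 : (2 : F) ≠ 0)
    (hs : IsSymplecticForm s) {lam : F}
    (hl : lam ≠ 2) (hl' : lam ≠ -2) {P : Submodule F V} (hP : Module.finrank F P ≤ 2)
    (hP0 : P ≠ ⊥) (u : Sp s) (hsub : ∀ x, (u : V ≃ₗ[F] V) x - x ∈ P)
    (hadd : ∀ x ∈ P, (u : V ≃ₗ[F] V) x + (u : V ≃ₗ[F] V).symm x = lam • x) :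
    ¬ IsReflectional 3 u := by
  rintro ⟨l, hlen, hinv, hprod⟩
  obtain ⟨a, b, c, rfl⟩ := List.length_eq_three.mp hlen
  have ha : a ^ 2 = 1 := hinv a (by simp)
  have hb : b ^ 2 = 1 := hinv b (by simp)
  have hc : c ^ 2 = 1 := hinv c (by simp)
  have hab : a * b = u * c := by
    rw [← hprod]
    simp [mul_assoc, ← sq, hc]
  refine ThreeInvolutions.elim (s := s) (P := P) (lam := lam)
    (u := (u : V ≃ₗ[F] V).toLinearMap) (u' := (u : V ≃ₗ[F] V).symm.toLinearMap)
    (a := (a : V ≃ₗ[F] V).toLinearMap) (b := (b : V ≃ₗ[F] V).toLinearMap)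
    (c := (c : V ≃ₗ[F] V).toLinearMap)
    { two_ne := h2
      lam_ne := hl
      lam_ne' := hl'
      alt := hs.alt
      sep := hs.nondegenerate.1
      finrank_le := hP
      ne_bot := hP0
      sub_mem := hsub
      add_eq := hadd
      u_u' := (u : V ≃ₗ[F] V).apply_symm_apply
      u'_u := (u : V ≃ₗ[F] V).symm_apply_apply
      adj_u := Sp.apply_adjoint u
      adj_a := Sp.involution_adjoint ha
      adj_b := Sp.involution_adjoint hb
      adj_c := Sp.involution_adjoint hc
      aa := Sp.involution_apply ha
      bb := Sp.involution_apply hb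
      cc := Sp.involution_apply hc
      eq := fun x => LinearEquiv.congr_fun (congrArg Subtype.val hab) x }

theorem IsReflectional.mono {G : Type*} [Group G] {k m : ℕ} (hkm : k ≤ m) {g : G}
    (h : IsReflectional k g) : IsReflectional m g := by
  obtain ⟨l, hlen, hinv, hprod⟩ := h
  -- Padding is allowed because the identity counts as an involution.
  refine ⟨l ++ List.replicate (m - k) 1, by simp [hlen, hkm], fun i hi => ?_, by simp [hprod]⟩
  rcases List.mem_append.mp hi with hi | hi
  · exact hinv i hi
  · rw [List.eq_of_mem_replicate hi, one_pow]

theorem four_le_reflectionalLength {G : Type*} [Group G] {g : G} (hg : ¬ IsReflectional 3 g) :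
    4 ≤ reflectionalLength G := by
  refine le_iInf fun k => le_iInf fun hk => ?_
  by_contra! hlt
  have hlt' : k < 4 := by exact_mod_cast hlt
  exact hg ((hk g).mono (by omega))

end Main

/-- A monic palindromial of degree `2` without the root `1` is `t² - lam t + 1`. -/
theorem IsPalindromial.exists_eq {F : Type*} [Field F] (h2 : (2 : F) ≠ 0) {p : F[X]}
    (hm : p.Monic) (hd : p.natDegree = 2) (hp : IsPalindromial p) (h1 : ¬ p.IsRoot 1) :
    ∃ lam : F, p = X ^ 2 - C lam * X + 1 := by
  have hc2 : p.coeff 2 = 1 := by rw [← hd]; exact hm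
  have hcoeff : ∀ n, p.coeff n = (p.coeff 0)⁻¹ * p.coeff (Polynomial.revAt 2 n) := by
    intro n
    conv_lhs => rw [hp.2]
    rw [reciprocalPoly, coeff_C_mul, coeff_reverse, hd, coeff_zero_eq_eval_zero]
  have e0 := hcoeff 0
  have e1 := hcoeff 1
  have e2 := hcoeff 2
  rw [revAt_le (by norm_num), Nat.sub_zero, hc2, mul_one] at e0
  rw [revAt_le (by norm_num)] at e1
  have hform : p = X ^ 2 + C (p.coeff 1) * X + C (p.coeff 0) := by
    conv_lhs => rw [p.as_sum_range_C_mul_X_pow, hd]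
    simp only [Finset.sum_range_succ, Finset.sum_range_zero, hc2]
    simp
    ring
  have hne : p.coeff 0 ≠ 0 := by
    intro h0
    rw [h0, hc2] at e2
    simp at e2
  have hsq : p.coeff 0 * p.coeff 0 = 1 := by
    nth_rewrite 1 [e0]
    exact inv_mul_cancel₀ hne
  rcases mul_self_eq_one_iff.mp hsq with h0 | h0
  · refine ⟨-p.coeff 1, ?_⟩
    conv_lhs => rw [hform, h0]
    simp
  -- If `p(0) = -1`, the middle coefficient is its own negative, so `p = t² - 1` has the excluded
  -- root `1`.
  · exfalso
    have e1' : p.coeff 1 = -p.coeff 1 := by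
      rw [h0] at e1
      norm_num at e1
      exact e1
    have e3 : (2 : F) * p.coeff 1 = 0 := by linear_combination e1'
    have e4 := (mul_eq_zero.mp e3).resolve_left h2
    apply h1
    rw [hform, h0, e4]
    simp

/-- A symplectic transformation with minimal polynomial `(t - 1) p(t)`, where `p` is a palindromial
of degree `2` without the roots `±1` and the kernel of `p(u)` has dimension `2`, is not
`3`-reflectional. -/
theorem Sp.not_isReflectional_three_of_minpoly {F V : Type*} [Field F] [AddCommGroup V] [Module F V]
    [FiniteDimensional F V] {s : LinearMap.BilinForm F V} (h2 : (2 : F) ≠ 0)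
    (hs : IsSymplecticForm s) {p : F[X]} (hm : p.Monic) (hd : p.natDegree = 2)
    (hp : IsPalindromial p) (h1 : ¬ p.IsRoot 1) (h1' : ¬ p.IsRoot (-1)) (u : Sp s)
    (hmin : minpoly F ((u : V ≃ₗ[F] V) : V →ₗ[F] V) = (X - 1) * p)
    (hker : Module.finrank F
      (LinearMap.ker (aeval ((u : V ≃ₗ[F] V) : V →ₗ[F] V) p)) = 2) :
    ¬ IsReflectional 3 u := by
  obtain ⟨lam, rfl⟩ := hp.exists_eq h2 hm hd h1
  refine Sp.not_isReflectional_three h2 hs (lam := lam) ?_ ?_ hker.le ?_ u ?_ ?_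
  · rintro rfl
    apply h1
    simp
    norm_num
  · rintro rfl
    apply h1'
    simp
    norm_num
  · intro hbot
    rw [hbot, finrank_bot] at hker
    omega
  · intro x
    have h := minpoly.aeval F ((u : V ≃ₗ[F] V) : V →ₗ[F] V)
    rw [hmin, mul_comm, map_mul] at h
    have hx := LinearMap.congr_fun h x
    rw [LinearMap.mem_ker]
    simpa using hx
  · intro x hx
    rw [LinearMap.mem_ker] at hx
    have h := congrArg (u : V ≃ₗ[F] V).symm hx
    simp [pow_two] at h
    linear_combination (norm := module) h

/-- The quarter turn `e ↦ f ↦ -e` of a hyperbolic plane, extended by the identity, is not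
`3`-reflectional. -/
theorem exists_not_isReflectional_three {F V : Type*} [Field F] [AddCommGroup V] [Module F V]
    [FiniteDimensional F V] {s : LinearMap.BilinForm F V} (h2 : (2 : F) ≠ 0)
    (hs : IsSymplecticForm s) [Nontrivial V] : ∃ u : Sp s, ¬ IsReflectional 3 u := by
  obtain ⟨e, he0⟩ := exists_ne (0 : V)
  obtain ⟨f, hef⟩ : ∃ f, s e f = 1 := by
    obtain ⟨g, hg⟩ : ∃ g, s e g ≠ 0 := by
      by_contra! hcon
      exact he0 (hs.nondegenerate.1 e hcon)
    exact ⟨(s e g)⁻¹ • g, by simp [hg]⟩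
  have hee : ∀ x, s x x = 0 := hs.alt
  have hsw : ∀ x y, s x y = -s y x := fun x y => (LinearMap.IsAlt.neg hs.alt y x).symm
  have hfe : s f e = -1 := by rw [hsw, hef]
  let u₁ : V →ₗ[F] V := LinearMap.id - (s f).smulRight (f - e) - (s e).smulRight (e + f)
  let u₂ : V →ₗ[F] V := LinearMap.id + (s f).smulRight (f + e) + (s e).smulRight (e - f)
  have hu₁ : ∀ x, u₁ x = x - s f x • (f - e) - s e x • (e + f) := fun x => rfl
  have hu₂ : ∀ x, u₂ x = x + s f x • (f + e) + s e x • (e - f) := fun x => rfl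
  have h12 : ∀ x, u₁ (u₂ x) = x := by
    intro x
    rw [hu₁, hu₂]
    simp only [map_add, map_sub, map_smul, smul_eq_mul, hee, hef, hfe]
    module
  have h21 : ∀ x, u₂ (u₁ x) = x := by
    intro x
    rw [hu₂, hu₁]
    simp only [map_add, map_sub, map_smul, smul_eq_mul, hee, hef, hfe]
    module
  let u : V ≃ₗ[F] V := LinearEquiv.ofLinearMap u₁ u₂ (LinearMap.ext h12) (LinearMap.ext h21)
  have hu : u ∈ Sp s := by
    intro x y
    change s (u₁ x) (u₁ y) = s x y
    rw [hu₁, hu₁]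
    simp only [map_add, map_sub, map_smul, smul_eq_mul, LinearMap.add_apply, LinearMap.sub_apply,
      LinearMap.smul_apply, hee, hef, hfe]
    rw [hsw x e, hsw x f]
    ring
  have hemem : e ∈ Submodule.span F {e, f} := Submodule.subset_span (by simp)
  have hfmem : f ∈ Submodule.span F {e, f} := Submodule.subset_span (by simp)
  -- A quarter turn satisfies `u² = -1` on the plane, so `u + u⁻¹ = 0` there, and `0 ≠ ±2`.
  refine ⟨⟨u, hu⟩, Sp.not_isReflectional_three h2 hs (lam := 0) h2.symm
    (neg_ne_zero.mpr h2).symm (P := Submodule.span F {e, f}) ?_ ?_ _ ?_ ?_⟩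
  · classical
    have h := finrank_span_finset_le_card (R := F) ({e, f} : Finset V)
    rw [Finset.coe_pair] at h
    exact h.trans Finset.card_le_two
  · intro hbot
    rw [hbot] at hemem
    exact he0 hemem
  · intro x
    change u₁ x - x ∈ _
    have : u₁ x - x = (s f x - s e x) • e + (-s f x - s e x) • f := by
      rw [hu₁]
      module
    rw [this]
    exact Submodule.add_mem _ (Submodule.smul_mem _ _ hemem) (Submodule.smul_mem _ _ hfmem)
  · intro x hx
    change u₁ x + u₂ x = _
    obtain ⟨p, q, rfl⟩ := Submodule.mem_span_pair.mp hx
    rw [hu₁, hu₂]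
    simp only [map_add, map_smul, smul_eq_mul, hee, hef, hfe]
    module

theorem IsSymplecticForm.four_le_reflectionalLength {F V : Type*} [Field F] [AddCommGroup V]
    [Module F V] [FiniteDimensional F V] {s : LinearMap.BilinForm F V} (h2 : (2 : F) ≠ 0)
    (hs : IsSymplecticForm s) [Nontrivial V] : 4 ≤ reflectionalLength (Sp s) := by
  obtain ⟨u, hu⟩ := exists_not_isReflectional_three h2 hs
  exact _root_.four_le_reflectionalLength hu

theorem mainTheorem4 {F : Type*} [Field F] (hF : ringChar F ≠ 2) :
    (∀ (V : Type*) [AddCommGroup V] [Module F V] [FiniteDimensional F V]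
        (s : LinearMap.BilinForm F V), IsSymplecticForm s →
        ∀ p : Polynomial F, p.Monic → p.natDegree = 2 → IsPalindromial p →
          ¬ p.IsRoot 1 → ¬ p.IsRoot (-1) →
        ∀ u : Sp s,
          minpoly F ((u : V ≃ₗ[F] V) : V →ₗ[F] V) = (Polynomial.X - 1) * p →
          Module.finrank F
            (LinearMap.ker (Polynomial.aeval ((u : V ≃ₗ[F] V) : V →ₗ[F] V) p)) = 2 →
          ¬ IsReflectional 3 u) ∧
    (∀ n : ℕ, 2 ≤ n →
      4 ≤ ell2 F n ∧
      ∀ (W : Type*) [AddCommGroup W] [Module F W] [FiniteDimensional F W]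
        (s : LinearMap.BilinForm F W), IsSymplecticForm s → Module.finrank F W = 2 * n →
        4 ≤ reflectionalLength (Sp s)) := by
  have h2 : (2 : F) ≠ 0 := Ring.two_ne_zero hF
  refine ⟨?_, fun n hn => ⟨?_, ?_⟩⟩
  · intro V _ _ _ s hs p hm hd hp h1 h1' u hmin hker
    exact Sp.not_isReflectional_three_of_minpoly h2 hs hm hd hp h1 h1' u hmin hker
  · have : Nonempty (Fin n) := ⟨⟨0, by omega⟩⟩
    exact (isSymplecticForm_stdSymplecticForm F n).four_le_reflectionalLength h2
  · intro W _ _ _ s hs hW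
    have : Nontrivial W := Module.nontrivial_of_finrank_pos (R := F) (by omega)
    exact hs.four_le_reflectionalLength h2
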